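/- All spaces are Tychonoff. Let $D$ be a discrete space of cardinality $\omega_1$ and let $X=D\cup\{\infty\}$ be its one-point Lindelöfication: the points of $D$ are isolated, and the neighbourhoods of $\infty$ are the sets containing $\infty$ whose complement is countable. Let $F(X)$ be the free topological group of $X$, i.e. the abstract free group on $X$ with the finest group topology for which the inclusion $X\to F(X)$ is continuous. Definitions. A $P$-space is a space in which every $G_\delta$-set is open. A group $G$ with a topology is semitopological if its multiplication is separately continuous, and $\omega$-narrow if for every neighbourhood $U$ of the neutral element there is a countable $A\subset G$ with $UA=AU=G$. If $G$ acts continuously on a space $Z$, a $G$-compactification of $Z$ is a compactification of $Z$ to which the action extends as a continuous action of $G$. A continuous map $f:Y\to Z$ is skeletal if $\operatorname{Int}\overline{f(U)}\neq\varnothing$ for every non-empty open $U\subset Y$. A space $Z$ is skeletally (resp. openly) Dugundji if there are a non-zero cardinal $\tau$ and an inverse system $S=\{Z_\alpha,p^\beta_\alpha:\alpha\le\beta<\tau\}$ of spaces, with surjective skeletal (resp. open) continuous bonding maps, such that (i) $Z_0$ is separable metrizable, and for each $\alpha$ with $\alpha+1<\tau$ there is a separable metrizable space $M_\alpha$ such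 that $Z_{\alpha+1}$ embeds in $Z_\alpha\times M_\alpha$ with $p^{\alpha+1}_\alpha$ becoming the restriction of the projection onto $Z_\alpha$; (ii) for each limit ordinal $\gamma<\tau$ the natural map $Z_\gamma\to\varprojlim\{Z_\alpha,p^\beta_\alpha:\alpha\le\beta<\gamma\}$ is an embedding with dense image; (iii) $Z$ embeds in $\varprojlim S$ in such a way that every limit projection $p_\alpha$ maps $Z$ onto $Z_\alpha$; (iv) every bounded continuous $f:\varprojlim S\to\mathbb R$ is of the form $g\circ p_\alpha$ for some $\alpha<\tau$ and some continuous $g:Z_\alpha\to\mathbb R$. Statement. $X$ is a Tychonoff $P$-space all of whose finite powers are Lindelöf. The topological group $F(X)$ is Tychonoff, $\omega$-narrow, Lindelöf, a $P$-space, and has no isolated points; with respect to its action on itself by left translations it has an $F(X)$-compactification; but it is not skeletally Dugundji. Consequently, it is not true that every space $Z$ which admits a continuous transitive action of an $\omega$-narrow semitopological group $G$ such that $Z$ has a $G$-compactification is skeletally Dugundji, and it is not true that every such $Z$ is openly Dugundji. -/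

import Mathlib

open Set Topology
open scoped Pointwise BoundedContinuousFunction Cardinal

universe u

/-! ### General topology -/

/-- A `P`-space: every `G_δ`-set is open. -/
def IsPSpace (X : Type*) [TopologicalSpace X] : Prop :=
  ∀ s : Set X, IsGδ s → IsOpen s

/-- A continuous map is skeletal if `Int (cl (f U))` is non-empty for every non-empty open `U`. -/
def IsSkeletal {X Y : Type*} [TopologicalSpace X] [TopologicalSpace Y] (f : X → Y) : Prop :=
  Continuous f ∧ ∀ U : Set X, IsOpen U → U.Nonempty → (interior (closure (f '' U))).Nonempty

/-- Separable metrizable spaces. -/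
def IsSeparableMetrizable (M : Type*) [TopologicalSpace M] : Prop :=
  TopologicalSpace.SeparableSpace M ∧ TopologicalSpace.MetrizableSpace M

/-- `p : A → B` has a metrizable kernel: for some separable metrizable `M`, the space `A` embeds
in `B × M` in such a way that `p` becomes the restriction of the projection `B × M → B`. -/
def HasMetrizableKernel {A B : Type u} [TopologicalSpace A] [TopologicalSpace B]
    (p : A → B) : Prop :=
  ∃ (M : Type u) (_ : TopologicalSpace M) (i : A → B × M),
    IsSeparableMetrizable M ∧ IsEmbedding i ∧ ∀ a, (i a).1 = p a

/-! ### Inverse systems, skeletally and openly Dugundji spaces -/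

/-- An inverse system of Tychonoff spaces with continuous bonding maps `p^j_i : X_j → X_i`. -/
structure InvSystem (ι : Type*) [Preorder ι] where
  space : ι → Type u
  [top : ∀ i, TopologicalSpace (space i)]
  tychonoff : ∀ i, T35Space (space i)
  bond : ∀ ⦃i j : ι⦄, i ≤ j → space j → space i
  continuous_bond : ∀ ⦃i j : ι⦄ (h : i ≤ j), Continuous (bond h)
  bond_self : ∀ (i : ι) (x : space i), bond (le_refl i) x = x
  bond_bond : ∀ ⦃i j k : ι⦄ (hij : i ≤ j) (hjk : j ≤ k) (x : space k),
    bond hij (bond hjk x) = bond (hij.trans hjk) x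

attribute [instance] InvSystem.top

namespace InvSystem

variable {ι : Type*} [Preorder ι]

/-- The inverse limit: all threads, with the topology of a subspace of the product. -/
def Lim (S : InvSystem.{u} ι) : Type _ :=
  {x : ∀ i, S.space i // ∀ ⦃i j : ι⦄ (h : i ≤ j), S.bond h (x j) = x i}

instance (S : InvSystem.{u} ι) : TopologicalSpace S.Lim :=
  inferInstanceAs (TopologicalSpace
    {x : ∀ i, S.space i // ∀ ⦃i j : ι⦄ (h : i ≤ j), S.bond h (x j) = x i})

/-- The limit projection `p_i : lim S → X_i`. -/
def proj (S : InvSystem.{u} ι) (i : ι) (x : S.Lim) : S.space i := x.1 i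

/-- The subsystem of all `X_i` with `i < c`. -/
def below (S : InvSystem.{u} ι) (c : ι) : InvSystem.{u} (Set.Iio c) where
  space i := S.space i
  tychonoff i := S.tychonoff i
  bond _ _ h := S.bond h
  continuous_bond _ _ h := S.continuous_bond h
  bond_self i := S.bond_self i
  bond_bond _ _ _ hij hjk := S.bond_bond hij hjk

/-- The natural map `X_c → lim {X_i : i < c}`. -/
def toLimBelow (S : InvSystem.{u} ι) (c : ι) (x : S.space c) : (S.below c).Lim :=
  ⟨fun i => S.bond (le_of_lt i.2) x, fun _ j h => S.bond_bond h (le_of_lt j.2) x⟩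

end InvSystem

/-- `X` is the almost limit of a factorizing, almost continuous well ordered inverse system
`{X_α : α < τ}`, `τ` a non-zero cardinal, with surjective bonding maps satisfying `P`, such that
`X_0` is separable metrizable and all `p^{α+1}_α` have metrizable kernels. -/
def IsDugundjiFor
    (P : ∀ ⦃A B : Type u⦄ [TopologicalSpace A] [TopologicalSpace B], (A → B) → Prop)
    (X : Type u) [TopologicalSpace X] : Prop :=
  ∃ (τ : Cardinal.{u}) (h0 : 0 < τ.ord) (S : InvSystem.{u} (Set.Iio τ.ord)),
    (∀ ⦃α β : Set.Iio τ.ord⦄ (h : α ≤ β),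
      Function.Surjective (S.bond h) ∧ P (S.bond h)) ∧
    IsSeparableMetrizable (S.space ⟨0, h0⟩) ∧
    (∀ ⦃α β : Set.Iio τ.ord⦄ (h : α ≤ β), (β : Ordinal.{u}) = Order.succ (α : Ordinal.{u}) →
      HasMetrizableKernel (S.bond h)) ∧
    (∀ γ : Set.Iio τ.ord, Order.IsSuccLimit (γ : Ordinal.{u}) →
      IsDenseEmbedding (S.toLimBelow γ)) ∧
    (∃ e : X → S.Lim, IsEmbedding e ∧ ∀ α, Function.Surjective (fun x => S.proj α (e x))) ∧
    (∀ f : S.Lim →ᵇ ℝ, ∃ (α : Set.Iio τ.ord) (g : C(S.space α, ℝ)),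
      ∀ x, f x = g (S.proj α x))

/-- Skeletally Dugundji spaces. -/
def IsSkeletallyDugundji (X : Type u) [TopologicalSpace X] : Prop :=
  IsDugundjiFor (fun _ _ _ _ f => IsSkeletal f) X

/-- Openly Dugundji spaces. -/
def IsOpenlyDugundji (X : Type u) [TopologicalSpace X] : Prop :=
  IsDugundjiFor (fun _ _ _ _ f => IsOpenMap f) X

/-! ### Groups and actions -/

/-- `ω`-narrowness of a group with a topology. -/
def IsOmegaNarrow (G : Type*) [Group G] [TopologicalSpace G] : Prop :=
  ∀ U ∈ 𝓝 (1 : G), ∃ A : Set G, A.Countable ∧ U * A = univ ∧ A * U = univ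

/-- A group with a topology is semitopological if its multiplication is separately continuous. -/
def IsSemitopologicalGroup (G : Type*) [Group G] [TopologicalSpace G] : Prop :=
  ∀ a : G, Continuous (fun x : G => a * x) ∧ Continuous (fun x : G => x * a)

/-- The action of `G` on `X` extends to a continuous action of `G` on some
(Hausdorff) compactification of `X`. -/
def HasGCompactification (G X : Type u) [Group G] [TopologicalSpace G] [TopologicalSpace X]
    [MulAction G X] : Prop :=
  ∃ (Y : Type u) (_ : TopologicalSpace Y) (_ : MulAction G Y) (e : X → Y),
    CompactSpace Y ∧ T2Space Y ∧ ContinuousSMul G Y ∧ IsDenseEmbedding e ∧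
      ∀ (g : G) (x : X), e (g • x) = g • e x

/-! ### The one-point Lindelöfication -/

/-- The one-point Lindelöfication of a space `D`: one point `∞` is added, `D` is an open subspace,
and the neighbourhoods of `∞` are given by the complements of closed Lindelöf subsets of `D`. -/
def OnePointLindelof (D : Type u) : Type u := Option D

namespace OnePointLindelof

variable {D : Type u}

/-- The inclusion of `D`. -/
def coe (d : D) : OnePointLindelof D := some d

/-- The added point. -/
def infty : OnePointLindelof D := none

instance [TopologicalSpace D] : TopologicalSpace (OnePointLindelof D) where
  IsOpen U := IsOpen (coe ⁻¹' U) ∧ (infty ∈ U → IsLindelof (coe ⁻¹' U)ᶜ)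
  isOpen_univ := by simp
  isOpen_inter U V hU hV := by
    refine ⟨hU.1.inter hV.1, fun h => ?_⟩
    rw [preimage_inter, compl_inter]
    exact (hU.2 h.1).union (hV.2 h.2)
  isOpen_sUnion s hs := by
    have ho : IsOpen (coe ⁻¹' (⋃₀ s) : Set D) := by
      rw [preimage_sUnion]
      exact isOpen_biUnion fun t ht => (hs t ht).1
    refine ⟨ho, fun ⟨t, ht, hm⟩ => ?_⟩
    exact ((hs t ht).2 hm).of_isClosed_subset ho.isClosed_compl
      (compl_subset_compl.2 (preimage_mono (subset_sUnion_of_mem ht)))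

end OnePointLindelof

/-! ### Free topological groups -/

/-- The (Markov) free topological group `F(X)`: the abstract free group on `X` with the finest
group topology for which the canonical map `X → F(X)` is continuous. -/
def FreeTopGroup (X : Type u) : Type u := FreeGroup X

namespace FreeTopGroup

variable {X : Type u}

instance : Group (FreeTopGroup X) := inferInstanceAs (Group (FreeGroup X))

/-- The canonical map `X → F(X)`. -/
def of (x : X) : FreeTopGroup X := FreeGroup.of x

/-- The finest group topology making `of` continuous (in Mathlib's order on topologies the finer
topology is the smaller one). -/
def groupTopology (X : Type u) [TopologicalSpace X] : GroupTopology (FreeTopGroup X) :=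
  sInf {t | Continuous[inferInstance, t.toTopologicalSpace] (of : X → FreeTopGroup X)}

instance [TopologicalSpace X] : TopologicalSpace (FreeTopGroup X) :=
  (groupTopology X).toTopologicalSpace

instance [TopologicalSpace X] : IsTopologicalGroup (FreeTopGroup X) :=
  (groupTopology X).toIsTopologicalGroup

theorem continuous_of [TopologicalSpace X] : Continuous (of : X → FreeTopGroup X) := by
  change Continuous[_, (sInf _ : GroupTopology (FreeTopGroup X)).toTopologicalSpace] _
  rw [GroupTopology.toTopologicalSpace_sInf]
  refine continuous_sInf_rng.2 ?_
  rintro _ ⟨t, ht, rfl⟩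
  exact ht

/-- The universal property of `F(X)`: every continuous map from `X` to a topological group
extends to a continuous homomorphism on `F(X)`. -/
theorem exists_continuous_lift [TopologicalSpace X] {H : Type*} [Group H] [TopologicalSpace H]
    [IsTopologicalGroup H] (f : X → H) (hf : Continuous f) :
    ∃ φ : FreeTopGroup X →* H, Continuous φ ∧ ∀ x, φ (of x) = f x := by
  let φ : FreeTopGroup X →* H := (FreeGroup.lift f : FreeGroup X →* H)
  have hφ : ∀ x, φ (of x) = f x := fun x => FreeGroup.lift_apply_of
  refine ⟨φ, ?_, hφ⟩
  let t : GroupTopology (FreeTopGroup X) :=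
    { toTopologicalSpace := TopologicalSpace.induced φ inferInstance
      toIsTopologicalGroup := topologicalGroup_induced φ }
  have ht : groupTopology X ≤ t := by
    refine sInf_le ?_
    refine continuous_induced_rng.2 ?_
    have : φ ∘ of = f := funext hφ
    rw [this]
    exact hf
  exact continuous_iff_le_induced.2 ht

end FreeTopGroup

/-! Skeletally Dugundji spaces have the countable chain condition (ccc), and `F(X)` does not. Openly
Dugundji spaces are skeletally Dugundji, so `F(X)` acting on itself by left translations refutes
both general claims.

The ccc climbs the inverse system by transfinite induction. At a successor, the second countable
kernel splits a disjoint family into countably many pieces, each of which projects to a disjoint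
family below (`IsCCC.of_hasMetrizableKernel`). At limits, and for the space itself, an uncountable
disjoint family is refuted by closing a countable subfamily off and reflecting one further member at
the supremum of its indices (`isCCC_of_invSystem`).

For countable `E ⊆ D` the retraction of `X` onto `E ∪ {∞}` is locally constant, so it induces a
continuous homomorphism `r_E` into a discrete free group. The kernels of the `r_E` form a base at
`1`: `F(X)` is a Lindelöf `P`-group, hence has arbitrarily small open normal subgroups `N`, and `d
∞⁻¹ ∈ N` for all but countably many `d`, so the quotient by `N` factors through some `r_E`. With `D`
ordered in type `ω₁`, the sets `{r_{<d} = 1, r_{≤d} ≠ 1}` are uncountably many disjoint non-empty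
open sets. The indicators of the values `r_E(g)` embed `F(X)` equivariantly in a Cantor cube, which
yields the compactification. -/

/-! ### The countable chain condition -/

/-- The countable chain condition: disjoint families of non-empty open sets are countable. -/
def IsCCC (X : Type*) [TopologicalSpace X] : Prop :=
  ∀ s : Set (Set X), (∀ U ∈ s, IsOpen U ∧ U.Nonempty) → s.PairwiseDisjoint id → s.Countable

theorem IsCCC.countable_index {X : Type*} [TopologicalSpace X] (h : IsCCC X) {ι : Type*}
    (U : ι → Set X) (ho : ∀ i, IsOpen (U i)) (hn : ∀ i, (U i).Nonempty)
    (hd : ∀ i j, i ≠ j → Disjoint (U i) (U j)) : Countable ι := by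
  have hinj : Function.Injective U := by
    intro i j hij
    by_contra hne
    have := hd i j hne
    rw [← hij, disjoint_self] at this
    exact (hn i).ne_empty this
  have hc : (range U).Countable := by
    refine h _ ?_ ?_
    · rintro _ ⟨i, rfl⟩
      exact ⟨ho i, hn i⟩
    · rintro _ ⟨i, rfl⟩ _ ⟨j, rfl⟩ hne
      exact hd i j fun e => hne (by rw [e])
  have := hc.to_subtype
  exact (rangeFactorization_injective.2 hinj).countable

theorem isCCC_of_separableSpace (X : Type*) [TopologicalSpace X]
    [TopologicalSpace.SeparableSpace X] : IsCCC X := fun _ hs hd =>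
  hd.countable_of_isOpen (fun U hU => (hs U hU).1) (fun U hU => (hs U hU).2)

/-- In a space with the countable chain condition, every family of open sets has a countable
subfamily with union dense in the union of the whole family. -/
theorem IsCCC.exists_countable_dense {X : Type*} [TopologicalSpace X] (h : IsCCC X) {ι : Type*}
    (U : ι → Set X) :
    ∃ C : Set ι, C.Countable ∧ ∀ i, ∀ O, IsOpen O → O.Nonempty → O ⊆ U i →
      ∃ j ∈ C, (O ∩ U j).Nonempty := by
  -- A maximal disjoint family of non-empty open sets, each inside some `U i`, is countable; one
  -- index per member suffices.
  obtain ⟨s, hs⟩ := zorn_subset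
    {s : Set (Set X) | (∀ V ∈ s, (IsOpen V ∧ V.Nonempty) ∧ ∃ i, V ⊆ U i) ∧
      s.PairwiseDisjoint id} (by
    intro c hc hchain
    refine ⟨⋃₀ c, ⟨?_, ?_⟩, fun t ht => subset_sUnion_of_mem ht⟩
    · rintro V ⟨t, ht, hV⟩
      exact (hc ht).1 V hV
    · exact (pairwiseDisjoint_sUnion hchain.directedOn).2 fun t ht => (hc ht).2)
  have hcount : s.Countable := h s (fun V hV => (hs.prop.1 V hV).1) hs.prop.2
  choose g hg using fun V : s => (hs.prop.1 V V.2).2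
  have := hcount.to_subtype
  refine ⟨range g, countable_range g, fun i O hO hne hOU => ?_⟩
  by_contra hcon
  have hdis : ∀ V ∈ s, Disjoint O V := by
    intro V hV
    rw [Set.disjoint_iff_inter_eq_empty, ← not_nonempty_iff_eq_empty]
    intro hn
    exact hcon ⟨g ⟨V, hV⟩, mem_range_self _, hn.mono (inter_subset_inter_right _ (hg ⟨V, hV⟩))⟩
  have hins : insert O s ⊆ s := by
    refine hs.le_of_ge (y := insert O s) ⟨?_, ?_⟩ (subset_insert _ _)
    · rintro V (rfl | hV)
      · exact ⟨⟨hO, hne⟩, i, hOU⟩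
      · exact hs.prop.1 V hV
    · exact hs.prop.2.insert fun V hV _ => hdis V hV
  have := hdis O (hins (mem_insert _ _))
  rw [disjoint_self] at this
  exact hne.ne_empty this

theorem IsSeparableMetrizable.secondCountableTopology {M : Type*} [TopologicalSpace M]
    (h : IsSeparableMetrizable M) : SecondCountableTopology M := by
  have := h.1
  have := h.2
  let := TopologicalSpace.metrizableSpaceMetric M
  exact UniformSpace.secondCountable_of_separable M

/-- Skeletal preimages with metrizable kernel preserve the countable chain condition. -/
theorem IsCCC.of_hasMetrizableKernel {A B : Type u} [TopologicalSpace A] [TopologicalSpace B]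
    {p : A → B} (hB : IsCCC B) (hsk : IsSkeletal p) (hp : HasMetrizableKernel p) : IsCCC A := by
  obtain ⟨M, _, e, hM, he, hep⟩ := hp
  have := hM.secondCountableTopology
  have hb := TopologicalSpace.isBasis_countableBasis M
  intro s hs hd
  have key : ∀ V ∈ s, ∃ (O : Set B) (N : Set M), IsOpen O ∧
      N ∈ TopologicalSpace.countableBasis M ∧ (e ⁻¹' (O ×ˢ N)).Nonempty ∧
      e ⁻¹' (O ×ˢ N) ⊆ V := by
    intro V hV
    obtain ⟨x, hx⟩ := (hs V hV).2
    obtain ⟨V', hV', rfl⟩ := he.isOpen_iff.1 (hs V hV).1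
    obtain ⟨O, N₀, hO, hN₀, hxO, hxN, hsub⟩ := isOpen_prod_iff.1 hV' (e x).1 (e x).2 hx
    obtain ⟨N, hN, hxN', hNsub⟩ := hb.exists_subset_of_mem_open hxN hN₀
    exact ⟨O, N, hO, hN, ⟨x, hxO, hxN'⟩,
      preimage_mono ((prod_mono_right hNsub).trans hsub)⟩
  choose! O N hO hN hne hsub using key
  have hcover : s ⊆ ⋃ n ∈ TopologicalSpace.countableBasis M, {V ∈ s | N V = n} := fun V hV =>
    mem_biUnion (hN V hV) ⟨hV, rfl⟩
  refine Countable.mono hcover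
    ((TopologicalSpace.countable_countableBasis M).biUnion fun n hn => ?_)
  have hopen : ∀ V ∈ s, IsOpen (e ⁻¹' (O V ×ˢ N V)) := fun V hV =>
    ((hO V hV).prod (hb.isOpen (hN V hV))).preimage he.continuous
  -- For a fixed second factor `n` these sets are disjoint: a common point yields `x` over `O V × n`
  -- with `p x ∈ O V'`, so `x` also lies over `O V' × n`, hence in both `V` and `V'`.
  refine Set.countable_coe_iff.1 <| hB.countable_index
    (fun V : {V ∈ s | N V = n} => O V ∩ interior (closure (p '' (e ⁻¹' (O V ×ˢ N V)))))
    (fun V => (hO V V.2.1).inter isOpen_interior) (fun V => ?_) (fun V V' hVV' => ?_)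
  · obtain ⟨y, hy⟩ := hsk.2 _ (hopen V V.2.1) (hne V V.2.1)
    obtain ⟨z, hz, x, hx, rfl⟩ :=
      mem_closure_iff.1 (interior_subset hy) _ isOpen_interior hy
    exact ⟨p x, by simpa [hep] using hx.1, hz⟩
  · rw [Set.disjoint_iff_inter_eq_empty, ← not_nonempty_iff_eq_empty]
    rintro ⟨y, hy, hy'⟩
    obtain ⟨z, hz, x, hx, rfl⟩ :=
      mem_closure_iff.1 (interior_subset hy.2) _ (hO V' V'.2.1) hy'.1
    have hx' : x ∈ e ⁻¹' (O V' ×ˢ N V') := by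
      refine ⟨by rwa [hep], ?_⟩
      rw [V'.2.2, ← V.2.2]
      exact hx.2
    exact Set.disjoint_left.1 (hd V.2.1 V'.2.1 fun h => hVV' (Subtype.ext h))
      (hsub V V.2.1 hx) (hsub V' V'.2.1 hx')

theorem InvSystem.exists_proj_preimage_subset {ι : Type*} [LinearOrder ι] [Nonempty ι]
    (S : InvSystem.{u} ι) {V : Set S.Lim} (hV : IsOpen V) {x : S.Lim} (hx : x ∈ V) :
    ∃ (i : ι) (O : Set (S.space i)), IsOpen O ∧ S.proj i x ∈ O ∧ S.proj i ⁻¹' O ⊆ V := by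
  obtain ⟨V', hV', rfl⟩ := isOpen_induced_iff.1 hV
  obtain ⟨I, w, hw, hsub⟩ := isOpen_pi_iff.1 hV' x.1 hx
  obtain ⟨i, hi⟩ := I.exists_le
  refine ⟨i, ⋂ j : I, S.bond (hi j j.2) ⁻¹' w j,
    isOpen_iInter_of_finite fun j => (hw j j.2).1.preimage (S.continuous_bond _), ?_, ?_⟩
  · refine mem_iInter.2 fun j => ?_
    have := (hw j j.2).2
    rwa [← x.2 (hi j j.2)] at this
  · intro y hy
    refine hsub fun j hj => ?_
    have := mem_iInter.1 hy ⟨j, hj⟩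
    rw [← y.2 (hi j hj)]
    exact this

theorem InvSystem.exists_bond_preimage_subset {ι : Type*} [LinearOrder ι]
    (S : InvSystem.{u} ι) {δ : ι} (hδ : IsEmbedding (S.toLimBelow δ)) (hne : (Iio δ).Nonempty)
    {V : Set (S.space δ)} (hV : IsOpen V) {x : S.space δ} (hx : x ∈ V) :
    ∃ (i : ι) (hi : i < δ) (O : Set (S.space i)), IsOpen O ∧ S.bond hi.le x ∈ O ∧
      S.bond hi.le ⁻¹' O ⊆ V := by
  obtain ⟨V', hV', rfl⟩ := hδ.isOpen_iff.1 hV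
  have := hne.to_subtype
  obtain ⟨i, O, hO, hxO, hsub⟩ := (S.below δ).exists_proj_preimage_subset hV' hx
  exact ⟨i, i.2, O, hO, hxO, fun y hy => hsub hy⟩

/-- Closing-off argument: iterate `step` countably often from `a₀` and take the union. -/
theorem exists_countable_closed {α : Type*} (step : α → Set α) (hstep : ∀ a, (step a).Countable)
    (a₀ : α) : ∃ A : Set α, A.Countable ∧ a₀ ∈ A ∧ ∀ a ∈ A, step a ⊆ A := by
  let A : ℕ → Set α := fun n => Nat.rec {a₀} (fun _ s => ⋃ a ∈ s, step a) n
  have hA : ∀ n, (A n).Countable := by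
    intro n
    induction n with
    | zero => exact countable_singleton a₀
    | succ n ih => exact ih.biUnion fun a _ => hstep a
  refine ⟨⋃ n, A n, countable_iUnion hA, mem_iUnion.2 ⟨0, rfl⟩, fun a ha => ?_⟩
  obtain ⟨n, hn⟩ := mem_iUnion.1 ha
  exact (subset_biUnion_of_mem (u := step) hn).trans (subset_iUnion A (n + 1))

/-- A space whose topology is generated by a compatible family of surjections onto an initial part
of a well ordered, almost continuous inverse system of spaces with the countable chain condition
and skeletal bonding maps has the countable chain condition. -/
theorem isCCC_of_invSystem {ι : Type*} [LinearOrder ι] [WellFoundedLT ι] (S : InvSystem.{u} ι)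
    (hsurj : ∀ ⦃i j : ι⦄ (h : i ≤ j), Function.Surjective (S.bond h))
    (hsk : ∀ ⦃i j : ι⦄ (h : i ≤ j), IsSkeletal (S.bond h))
    (hlim : ∀ δ : ι, Order.IsSuccLimit δ → IsEmbedding (S.toLimBelow δ))
    {J : Set ι} (hJ : IsLowerSet J) (hccc : ∀ i ∈ J, IsCCC (S.space i))
    {Y : Type*} [TopologicalSpace Y] (f : ∀ i : J, Y → S.space i)
    (hf : ∀ i, Function.Surjective (f i))
    (hcomp : ∀ ⦃i j : J⦄ (h : (i : ι) ≤ j) (y : Y), S.bond h (f j y) = f i y)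
    (hbase : ∀ V : Set Y, IsOpen V → V.Nonempty →
      ∃ (i : J) (W : Set (S.space i)), IsOpen W ∧ W.Nonempty ∧ f i ⁻¹' W ⊆ V) :
    IsCCC Y := by
  intro s hs hd
  by_contra hunc
  choose a W hWo hWn hWsub using fun V : s => hbase V (hs V V.2).1 (hs V V.2).2
  have hdisj : ∀ ξ η : s, ξ ≠ η → ∀ (k : J) (h : (a ξ : ι) ≤ k) (h' : (a η : ι) ≤ k),
      Disjoint (S.bond h ⁻¹' W ξ) (S.bond h' ⁻¹' W η) := by
    intro ξ η hne k h h'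
    refine Set.disjoint_left.2 fun z hz hz' => ?_
    obtain ⟨y, rfl⟩ := hf k z
    rw [mem_preimage, hcomp] at hz hz'
    exact Set.disjoint_left.1 (hd ξ.2 η.2 fun e => hne (Subtype.ext e))
      (hWsub ξ hz) (hWsub η hz')
  have hcount : ∀ β : J, {ξ : s | (a ξ : ι) ≤ β}.Countable := fun β =>
    Set.countable_coe_iff.1 <| (hccc β β.2).countable_index
      (fun ξ : {ξ : s | (a ξ : ι) ≤ β} => S.bond ξ.2 ⁻¹' W ξ)
      (fun ξ => (hWo ξ).preimage (S.continuous_bond _))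
      (fun ξ => (hWn ξ).preimage (hsurj _))
      (fun ξ η hne => hdisj ξ η (fun e => hne (Subtype.ext e)) β _ _)
  have huniv : ¬ (univ : Set s).Countable := fun h => hunc (Set.countable_coe_iff.1
    (Set.countable_univ_iff.1 h))
  -- Otherwise every index lies below one of countably many, and `hcount` makes the family
  -- countable.
  have hbig : ∀ A : Set s, A.Countable → ∃ η : s, ∀ ξ ∈ A, (a ξ : ι) < a η := by
    intro A hA
    by_contra! hcon
    refine huniv ((hA.biUnion fun ξ _ => hcount (a ξ)).mono fun η _ => ?_)
    obtain ⟨ξ, hξ, hle⟩ := hcon η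
    exact mem_biUnion hξ hle
  -- At each level `α`, countably many members already meet every open set in which the image of
  -- some member is dense.
  have hdense : ∀ α : J, ∃ C : Set s, C.Countable ∧ ∀ η : s, ∀ hη : (α : ι) ≤ a η,
      ∀ O : Set (S.space α), IsOpen O → O.Nonempty → O ⊆ closure (S.bond hη '' W η) →
      ∃ ξ ∈ C, ∃ hξ : (α : ι) ≤ a ξ, (O ∩ S.bond hξ '' W ξ).Nonempty := by
    intro α
    obtain ⟨C, hC, hC'⟩ := (hccc α α.2).exists_countable_dense
      (fun η : {η : s // (α : ι) ≤ a η} => interior (closure (S.bond η.2 '' W η)))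
    refine ⟨Subtype.val '' C, hC.image _, fun η hη O hO hOn hsub => ?_⟩
    obtain ⟨ξ, hξ, z, hzO, hz⟩ := hC' ⟨η, hη⟩ O hO hOn (interior_maximal hsub hO)
    exact ⟨ξ, mem_image_of_mem _ hξ, ξ.2, mem_closure_iff.1 (interior_subset hz) O hO hzO⟩
  choose C hC hCd using hdense
  choose next hnext using fun ξ : s => hbig {ξ} (countable_singleton ξ)
  obtain ⟨ξ₀, -⟩ := hbig ∅ countable_empty
  -- Closure under `C` makes the reflection below possible; closure under `next` makes the supremum
  -- `δ` of the indices a limit.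
  obtain ⟨A, hA, hξ₀, hAcl⟩ := exists_countable_closed (fun ξ => insert (next ξ) (C (a ξ)))
    (fun ξ => (hC _).insert _) ξ₀
  obtain ⟨η, hη⟩ := hbig A hA
  have hδex : ∃ δ : ι, (∀ ξ ∈ A, (a ξ : ι) < δ) ∧
      ∀ k : ι, (∀ ξ ∈ A, (a ξ : ι) < k) → δ ≤ k := by
    let T : Set ι := {k | ∀ ξ ∈ A, (a ξ : ι) < k}
    have hT : T.Nonempty := ⟨a η, hη⟩
    exact ⟨wellFounded_lt.min T hT, wellFounded_lt.min_mem T hT,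
      fun k hk => not_lt.1 (wellFounded_lt.not_lt_min T hk)⟩
  obtain ⟨δ, hAδ, hδmin⟩ := hδex
  have hδη : δ ≤ a η := hδmin _ hη
  have hδJ : δ ∈ J := hJ hδη (a η).2
  have hcof : ∀ α < δ, ∃ ξ ∈ A, α ≤ a ξ := by
    intro α hα
    by_contra! hcon
    exact absurd (hδmin α hcon) (not_le.2 hα)
  have hδlim : Order.IsSuccLimit δ := by
    refine ⟨fun hmin => (hAδ ξ₀ hξ₀).not_ge (hmin (hAδ ξ₀ hξ₀).le), fun α hα => ?_⟩
    obtain ⟨ξ, hξ, hle⟩ := hcof α hα.lt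
    exact hα.2 (hle.trans_lt (hnext ξ ξ rfl)) (hAδ _ (hAcl ξ hξ (mem_insert _ _)))
  -- The image of `W η` is somewhere dense at level `δ`; since `δ` is a limit, this is witnessed by
  -- an open set coming from a level `a ξ` with `ξ ∈ A`.
  obtain ⟨z, hz⟩ := (hsk hδη).2 _ (hWo η) (hWn η)
  obtain ⟨α', hα', O', hO', hzO', hO'sub⟩ := S.exists_bond_preimage_subset (hlim δ hδlim)
    ⟨_, hAδ ξ₀ hξ₀⟩ isOpen_interior hz
  obtain ⟨ξ, hξ, hαξ⟩ := hcof α' hα'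
  have hξδ := hAδ ξ hξ
  have hOsub : S.bond hξδ.le ⁻¹' (S.bond hαξ ⁻¹' O') ⊆
      closure (S.bond hδη '' W η) := by
    intro y hy
    refine interior_subset (hO'sub ?_)
    rwa [mem_preimage, mem_preimage, S.bond_bond] at hy
  -- Reflection: some `ξ' ∈ A` has an image meeting that open set. Lifted to level `δ`, its set `W
  -- ξ'` must meet the image of `W η`, against disjointness.
  obtain ⟨ξ', hξ', hle, _, hwO, w, hw, rfl⟩ := hCd (a ξ) η (hξδ.le.trans hδη)
    (S.bond hαξ ⁻¹' O') (hO'.preimage (S.continuous_bond _))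
    ⟨S.bond hξδ.le z, by rwa [mem_preimage, S.bond_bond]⟩ (by
      intro o ho
      obtain ⟨y, rfl⟩ := hsurj hξδ.le o
      have := image_closure_subset_closure_image (S.continuous_bond hξδ.le)
        (mem_image_of_mem _ (hOsub ho))
      rw [image_image] at this
      simpa only [S.bond_bond] using this)
  have hξ'A : ξ' ∈ A := hAcl ξ hξ (mem_insert_of_mem _ hξ')
  have hξ'δ := hAδ ξ' hξ'A
  obtain ⟨y, rfl⟩ := hsurj hξ'δ.le w
  rw [S.bond_bond] at hwO
  obtain ⟨_, hy, w', hw', rfl⟩ := mem_closure_iff.1 (hOsub hwO) _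
    ((hWo ξ').preimage (S.continuous_bond hξ'δ.le)) hw
  rw [mem_preimage, S.bond_bond] at hy
  refine Set.disjoint_left.1 (hdisj ξ' η ?_ (a η) (hξ'δ.le.trans hδη) le_rfl) hy ?_
  · rintro rfl
    exact absurd (hξ'δ.trans_le hδη) (lt_irrefl _)
  · rwa [mem_preimage, S.bond_self]

/-- Skeletally Dugundji spaces have the countable chain condition. -/
theorem IsSkeletallyDugundji.isCCC {X : Type u} [TopologicalSpace X]
    (h : IsSkeletallyDugundji X) : IsCCC X := by
  obtain ⟨τ, h0, S, hbond, hzero, hsucc, hlim, ⟨e, he, hesurj⟩, -⟩ := h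
  -- An initial segment of the ordinals has the same limits.
  have hcoe : ∀ γ : Iio τ.ord, Order.IsSuccLimit γ → Order.IsSuccLimit (γ : Ordinal.{u}) := by
    intro γ hγ
    refine ⟨fun hmin => hγ.1 fun β hβ => hmin hβ, fun α hα => ?_⟩
    have hατ : α < τ.ord := hα.lt.trans γ.2
    exact hγ.2 ⟨α, hατ⟩ ⟨hα.lt, fun β h₁ h₂ => hα.2 h₁ h₂⟩
  have hccc : ∀ γ : Iio τ.ord, IsCCC (S.space γ) := by
    intro γ
    induction γ using WellFoundedLT.induction with
    | ind γ ih =>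
    by_cases hγ : Order.IsSuccLimit γ
    · have hne : (Iio γ).Nonempty := by simpa [isMin_iff_forall_not_lt] using hγ.1
      refine isCCC_of_invSystem S (fun _ _ h => (hbond h).1) (fun _ _ h => (hbond h).2)
        (fun δ hδ => (hlim δ (hcoe δ hδ)).isEmbedding) (isLowerSet_Iio γ) ih
        (fun i => S.bond i.2.le) (fun i => (hbond _).1) (fun i j h y => S.bond_bond _ _ _) ?_
      rintro V hV ⟨x, hx⟩
      obtain ⟨i, hi, O, hO, hxO, hsub⟩ := S.exists_bond_preimage_subset
        (hlim γ (hcoe γ hγ)).isEmbedding hne hV hx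
      exact ⟨⟨i, hi⟩, O, hO, ⟨_, hxO⟩, hsub⟩
    · rcases Order.not_isSuccLimit_iff.1 hγ with hmin | hpre
      · have : γ = ⟨0, h0⟩ := le_antisymm
          (hmin (show (0 : Ordinal.{u}) ≤ γ from zero_le)) (show (0 : Ordinal.{u}) ≤ γ from zero_le)
        subst this
        have := hzero.1
        exact isCCC_of_separableSpace _
      · obtain ⟨β, hβ⟩ := Order.not_isSuccPrelimit_iff.1 hpre
        refine (ih β hβ.lt).of_hasMetrizableKernel (hbond hβ.le).2 (hsucc hβ.le ?_)
        refine le_antisymm ?_ (Order.succ_le_of_lt hβ.lt)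
        by_contra! hlt
        exact hβ.2 (c := ⟨Order.succ (β : Ordinal), hlt.trans γ.2⟩) 
          (Order.lt_succ (β : Ordinal.{u})) hlt
  have : Nonempty (Iio τ.ord) := ⟨⟨0, h0⟩⟩
  refine isCCC_of_invSystem S (fun _ _ h => (hbond h).1) (fun _ _ h => (hbond h).2)
    (fun δ hδ => (hlim δ (hcoe δ hδ)).isEmbedding) isLowerSet_univ (fun i _ => hccc i)
    (fun i x => S.proj i (e x)) (fun i => hesurj i) (fun i j h y => (e y).2 h) ?_
  rintro V hV ⟨x, hx⟩
  obtain ⟨V', hV', rfl⟩ := he.isOpen_iff.1 hV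
  obtain ⟨i, O, hO, hxO, hsub⟩ := S.exists_proj_preimage_subset hV' hx
  exact ⟨⟨i, mem_univ _⟩, O, hO, ⟨_, hxO⟩, fun y hy => hsub hy⟩

theorem IsOpenlyDugundji.isSkeletallyDugundji {X : Type u} [TopologicalSpace X]
    (h : IsOpenlyDugundji X) : IsSkeletallyDugundji X := by
  obtain ⟨τ, h0, S, hbond, h⟩ := h
  refine ⟨τ, h0, S, fun α β hαβ => ⟨(hbond hαβ).1, S.continuous_bond hαβ, fun U hU hne => ?_⟩, h⟩
  exact (hne.image _).mono (interior_maximal subset_closure ((hbond hαβ).2 U hU))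

/-! ### `P`-spaces -/

theorem IsPSpace.countableInterFilter_nhds {X : Type*} [TopologicalSpace X] (h : IsPSpace X)
    (x : X) : CountableInterFilter (𝓝 x) where
  countable_sInter_mem T hT hmem := by
    have hopen : IsOpen (⋂ t ∈ T, interior t) :=
      h _ (IsGδ.biInter_of_isOpen hT fun _ _ => isOpen_interior)
    refine Filter.mem_of_superset (hopen.mem_nhds ?_) (subset_sInter fun t ht => ?_)
    · exact mem_iInter₂.2 fun t ht => mem_interior_iff_mem_nhds.2 (hmem t ht)
    · exact (biInter_subset_of_mem ht).trans interior_subset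

/-- The `P`-modification of a space: the topology with the `G_δ`-sets as a base. -/
def PModification (X : Type*) : Type _ := X

namespace PModification

variable {X : Type*}

instance [Group X] : Group (PModification X) := inferInstanceAs (Group X)

variable [TopologicalSpace X]

instance : TopologicalSpace (PModification X) where
  IsOpen U := ∀ x ∈ U, ∃ s : Set X, IsGδ s ∧ x ∈ s ∧ s ⊆ U
  isOpen_univ x _ := ⟨univ, IsGδ.univ, mem_univ x, subset_univ _⟩
  isOpen_inter U V hU hV x hx := by
    obtain ⟨s, hs, hxs, hsU⟩ := hU x hx.1
    obtain ⟨t, ht, hxt, htV⟩ := hV x hx.2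
    exact ⟨s ∩ t, hs.inter ht, ⟨hxs, hxt⟩, inter_subset_inter hsU htV⟩
  isOpen_sUnion T hT x hx := by
    obtain ⟨U, hU, hxU⟩ := hx
    obtain ⟨s, hs, hxs, hsU⟩ := hT U hU x hxU
    exact ⟨s, hs, hxs, hsU.trans (subset_sUnion_of_mem hU)⟩

theorem isOpen_iff {U : Set (PModification X)} :
    IsOpen U ↔ ∀ x ∈ U, ∃ s : Set X, IsGδ s ∧ x ∈ s ∧ s ⊆ U := Iff.rfl

/-- The identity map from the `P`-modification. -/
def toOriginal (x : PModification X) : X := x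

theorem isOpen_preimage_toOriginal {s : Set X} (hs : IsGδ s) :
    IsOpen (toOriginal ⁻¹' s : Set (PModification X)) :=
  fun _ hx => ⟨s, hs, hx, subset_rfl⟩

theorem continuous_toOriginal : Continuous (toOriginal : PModification X → X) :=
  continuous_def.2 fun _ hs => isOpen_preimage_toOriginal hs.isGδ

theorem isPSpace : IsPSpace (PModification X) := by
  rintro _ ⟨T, hT, hTc, rfl⟩ x hx
  choose! s hs hxs hsub using fun t (ht : t ∈ T) => isOpen_iff.1 (hT t ht) x (hx t ht)
  exact ⟨⋂ t ∈ T, s t, IsGδ.biInter hTc hs, mem_iInter₂.2 hxs,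
    fun y hy t ht => hsub t ht (mem_iInter₂.1 hy t ht)⟩

instance (x : PModification X) : CountableInterFilter (𝓝 x) :=
  isPSpace.countableInterFilter_nhds x

theorem continuous_of_toOriginal {Z : Type*} [TopologicalSpace Z]
    (hZ : ∀ z : Z, CountableInterFilter (𝓝 z)) {f : Z → PModification X}
    (hf : Continuous (toOriginal ∘ f)) : Continuous f := by
  refine continuous_iff_continuousAt.2 fun z V hV => ?_
  obtain ⟨U, hUV, hU, hzU⟩ := mem_nhds_iff.1 hV
  obtain ⟨_, ⟨T, hT, hTc, rfl⟩, hz, hsub⟩ := isOpen_iff.1 hU _ hzU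
  have := hZ z
  refine Filter.mem_of_superset (x := ⋂ t ∈ T, (toOriginal ∘ f) ⁻¹' t)
    ((countable_bInter_mem hTc).2 fun t ht => ((hT t ht).preimage hf).mem_nhds (hz t ht))
    fun y hy => hUV (hsub fun t ht => mem_iInter₂.1 hy t ht)

instance [Group X] [IsTopologicalGroup X] : IsTopologicalGroup (PModification X) where
  continuous_mul := by
    refine continuous_of_toOriginal (fun z => ?_) ?_
    · rw [nhds_prod_eq, Filter.prod_eq_inf]
      infer_instance
    · have h : Continuous fun p : PModification X × PModification X =>
          toOriginal p.1 * toOriginal p.2 :=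
        (continuous_toOriginal.comp continuous_fst).mul
          (continuous_toOriginal.comp continuous_snd)
      exact h
  continuous_inv := by
    have h : Continuous fun p : PModification X => (toOriginal p)⁻¹ := continuous_toOriginal.inv
    exact continuous_of_toOriginal (fun z => inferInstance) h

end PModification

/-! ### Lindelöf groups -/

theorem exists_countable_mul_eq_univ {G : Type*} [Group G] [TopologicalSpace G]
    [IsTopologicalGroup G] [LindelofSpace G] {U : Set G} (hU : U ∈ 𝓝 (1 : G)) :
    ∃ A : Set G, A.Countable ∧ A * U = univ := by
  obtain ⟨A, hA, hcov⟩ := LindelofSpace.elim_nhds_subcover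
    (fun x : G => (fun y => x⁻¹ * y) ⁻¹' U) fun x =>
      (continuous_const_mul x⁻¹).continuousAt.preimage_mem_nhds (by simpa using hU)
  refine ⟨A, hA, eq_univ_of_forall fun y => ?_⟩
  obtain ⟨x, hx, hy⟩ := mem_iUnion₂.1 (hcov.symm ▸ mem_univ y)
  exact ⟨x, hx, x⁻¹ * y, hy, by simp⟩

theorem isOmegaNarrow_of_lindelofSpace (G : Type*) [Group G] [TopologicalSpace G]
    [IsTopologicalGroup G] [LindelofSpace G] : IsOmegaNarrow G := by
  intro U hU
  obtain ⟨A, hA, hAU⟩ := exists_countable_mul_eq_univ hU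
  -- Inverting `B * U⁻¹ = univ` covers the group by translates on the other side.
  obtain ⟨B, hB, hBU⟩ := exists_countable_mul_eq_univ (inv_mem_nhds_one G hU)
  refine ⟨A ∪ B⁻¹, hA.union ?_, ?_, ?_⟩
  · rw [← image_inv_eq_inv]
    exact hB.image _
  · refine univ_subset_iff.1 ?_
    rw [← inv_univ, ← hBU, mul_inv_rev, inv_inv]
    exact mul_subset_mul_left subset_union_right
  · exact univ_subset_iff.1 (hAU ▸ mul_subset_mul_right subset_union_left)

/-- In a Lindelöf `P`-group the open normal subgroups form a base at the neutral element. -/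
theorem exists_normal_subgroup_subset {G : Type*} [Group G] [TopologicalSpace G]
    [IsTopologicalGroup G] [LindelofSpace G] (hP : IsPSpace G) {U : Set G} (hU : U ∈ 𝓝 (1 : G)) :
    ∃ N : Subgroup G, N.Normal ∧ (N : Set G) ∈ 𝓝 (1 : G) ∧ (N : Set G) ⊆ U := by
  have := hP.countableInterFilter_nhds (1 : G)
  have hsplit : ∀ s : Set G, ∃ V : Set G, s ∈ 𝓝 (1 : G) → V ∈ 𝓝 (1 : G) ∧
      ∀ v ∈ V, ∀ w ∈ V, v / w ∈ s := by
    intro s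
    by_cases hs : s ∈ 𝓝 (1 : G)
    · obtain ⟨V, hV, h⟩ := exists_nhds_split_inv hs
      exact ⟨V, fun _ => ⟨hV, h⟩⟩
    · exact ⟨∅, fun h => absurd h hs⟩
  choose half hhalf using hsplit
  let V : ℕ → Set G := fun n => half^[n] U
  have hV0 : V 0 = U := rfl
  have hVs : ∀ n, V (n + 1) = half (V n) := fun n => Function.iterate_succ_apply' half n U
  have hV : ∀ n, V n ∈ 𝓝 (1 : G) := by
    intro n
    induction n with
    | zero => exact hU
    | succ n ih =>
      rw [hVs]
      exact (hhalf _ ih).1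
  -- Since `V (n + 1) / V (n + 1) ⊆ V n`, the intersection is closed under division; the
  -- `P`-property keeps it a neighbourhood of `1`.
  let H : Subgroup G := Subgroup.ofDiv (⋂ n, V n)
    ⟨1, mem_iInter.2 fun n => mem_of_mem_nhds (hV n)⟩ (by
      intro x hx y hy
      refine mem_iInter.2 fun n => ?_
      have hx' := mem_iInter.1 hx (n + 1)
      have hy' := mem_iInter.1 hy (n + 1)
      rw [hVs] at hx' hy'
      rw [← div_eq_mul_inv]
      exact (hhalf _ (hV n)).2 x hx' y hy')
  have hH : (H : Set G) ∈ 𝓝 (1 : G) := countable_iInter_mem.2 hV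
  obtain ⟨A, hA, hAH⟩ := exists_countable_mul_eq_univ hH
  refine ⟨H.normalCore, H.normalCore_normal, ?_, fun x hx =>
    mem_iInter.1 (H.normalCore_le hx) 0⟩
  -- As `A * H = univ`, each conjugate of `H` is conjugate by some `a ∈ A`, so the normal core is a
  -- countable intersection.
  refine Filter.mem_of_superset (x := ⋂ a ∈ A, (fun x => a⁻¹ * x * a) ⁻¹' (H : Set G))
    ((countable_bInter_mem hA).2 fun a _ => ?_) fun x hx b => ?_
  · have hc : Continuous fun x : G => a⁻¹ * x * a := by fun_prop
    exact hc.continuousAt.preimage_mem_nhds (by simpa using hH)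
  · obtain ⟨a, ha, h, hh, hb⟩ : b⁻¹ ∈ A * (H : Set G) := hAH ▸ mem_univ _
    obtain rfl : b = h⁻¹ * a⁻¹ := by rw [← inv_inv b, ← hb, mul_inv_rev]
    have := H.mul_mem (H.mul_mem (H.inv_mem hh) (mem_iInter₂.1 hx a ha)) hh
    simpa [mul_assoc] using this

/-- The closure of the image is compact and invariant, because each translation is continuous. -/
theorem hasGCompactification_of_isEmbedding {G X Y : Type u} [Group G] [TopologicalSpace G]
    [TopologicalSpace X] [MulAction G X] [TopologicalSpace Y] [CompactSpace Y] [T2Space Y]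
    [MulAction G Y] [ContinuousSMul G Y] {e : X → Y} (he : IsEmbedding e)
    (heq : ∀ (g : G) (x : X), e (g • x) = g • e x) : HasGCompactification G X := by
  let Z : SubMulAction G Y :=
    { carrier := closure (range e)
      smul_mem' := fun g y hy => map_mem_closure (continuous_const_smul g) hy (by
        rintro _ ⟨x, rfl⟩
        exact ⟨g • x, heq g x⟩) }
  have hmem : ∀ x, e x ∈ Z := fun x => subset_closure (mem_range_self x)
  refine ⟨Z, inferInstance, inferInstance, fun x => ⟨e x, hmem x⟩, ?_, inferInstance, ?_, ?_,
    fun g x => Subtype.ext (heq g x)⟩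
  · exact isCompact_iff_compactSpace.1 (isClosed_closure (s := range e)).isCompact
  · exact ⟨Continuous.subtype_mk
      (continuous_fst.smul (continuous_subtype_val.comp continuous_snd)) _⟩
  · have he' : IsEmbedding fun x => (⟨e x, hmem x⟩ : Z) := he.codRestrict (Z : Set Y) hmem
    refine { toIsInducing := he'.toIsInducing, injective := he'.injective, dense := ?_ }
    rintro ⟨y, hy⟩
    rw [closure_subtype, ← range_comp]
    exact hy

/-! ### The one-point Lindelöfication of a discrete space -/

namespace OnePointLindelof

variable {D : Type u}

open scoped Classical in
/-- The retraction onto `E ∪ {∞}` that sends `D \ E` to `∞`. -/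
noncomputable def retract (E : Set D) : OnePointLindelof D → OnePointLindelof D
  | some d => if d ∈ E then coe d else infty
  | none => infty

theorem retract_infty (E : Set D) : retract E infty = infty := rfl

theorem retract_coe_of_mem {E : Set D} {d : D} (h : d ∈ E) : retract E (coe d) = coe d :=
  if_pos h

theorem retract_coe_of_notMem {E : Set D} {d : D} (h : d ∉ E) : retract E (coe d) = infty :=
  if_neg h

theorem retract_retract {E E' : Set D} (h : E ⊆ E') (x : OnePointLindelof D) :
    retract E (retract E' x) = retract E x := by
  cases x with
  | none => rfl
  | some d =>
    change retract E (retract E' (coe d)) = retract E (coe d)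
    by_cases hd : d ∈ E'
    · rw [retract_coe_of_mem hd]
    · rw [retract_coe_of_notMem hd, retract_coe_of_notMem fun h' => hd (h h'), retract_infty]

variable [TopologicalSpace D] [DiscreteTopology D]

theorem isOpen_iff {U : Set (OnePointLindelof D)} :
    IsOpen U ↔ (infty ∈ U → ((coe ⁻¹' U)ᶜ : Set D).Countable) :=
  ⟨fun h hU => isLindelof_iff_countable.1 (h.2 hU),
    fun h => ⟨isOpen_discrete _, fun hU => isLindelof_iff_countable.2 (h hU)⟩⟩

theorem isClopen_of_infty_mem {U : Set (OnePointLindelof D)} (hU : IsOpen U) (h : infty ∈ U) :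
    IsClopen U :=
  ⟨⟨isOpen_iff.2 fun h' => absurd h h'⟩, hU⟩

theorem isClopen_singleton_coe (d : D) : IsClopen {(coe d : OnePointLindelof D)} := by
  refine ⟨⟨isOpen_iff.2 fun _ => ?_⟩, isOpen_iff.2 fun h => ?_⟩
  · refine (countable_singleton d).mono fun x hx => ?_
    exact Option.some_injective _ (not_not.1 hx)
  · exact absurd h (Option.some_ne_none d).symm

instance : T35Space (OnePointLindelof D) := by
  have : T1Space (OnePointLindelof D) := by
    refine ⟨fun x => ?_⟩
    cases x with
    | none => exact ⟨isOpen_iff.2 fun h => absurd rfl h⟩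
    | some d => exact (isClopen_singleton_coe d).1
  have : CompletelyRegularSpace (OnePointLindelof D) := by
    refine .of_isTopologicalBasis_clopens
      (TopologicalSpace.isTopologicalBasis_of_isOpen_of_nhds (fun _ h => h.2) fun x U hx hU => ?_)
    cases x with
    | none => exact ⟨U, isClopen_of_infty_mem hU hx, hx, subset_rfl⟩
    | some d => exact ⟨_, isClopen_singleton_coe d, rfl, singleton_subset_iff.2 hx⟩
  exact {}

theorem isPSpace : IsPSpace (OnePointLindelof D) := by
  rintro _ ⟨T, hT, hTc, rfl⟩
  refine isOpen_iff.2 fun h => ?_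
  refine (hTc.biUnion fun t ht => isOpen_iff.1 (hT t ht) (h t ht)).mono fun d hd => ?_
  by_contra hcon
  refine hd fun t ht => ?_
  by_contra htd
  exact hcon (mem_biUnion ht htd)

/-- A tube argument: countably many sets cover `{∞} × Y`, and by the `P`-property they cover some `V
× Y` with `V` a neighbourhood of `∞`. Only countably many slices remain. -/
instance lindelofSpace_prod {Y : Type*} [TopologicalSpace Y] [LindelofSpace Y] :
    LindelofSpace (OnePointLindelof D × Y) := by
  have hslice : ∀ x : OnePointLindelof D, IsLindelof (range fun y : Y => (x, y)) := fun x =>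
    isLindelof_range (by fun_prop)
  refine ⟨isLindelof_of_countable_subcover fun {ι} U hU hcov => ?_⟩
  obtain ⟨C, hC, hCcov⟩ := (hslice infty).elim_countable_subcover U hU
    ((subset_univ _).trans hcov)
  have hW : IsOpen (⋃ i ∈ C, U i) := isOpen_biUnion fun i _ => hU i
  choose A B hA hB hAinf hyB hsub using fun y : Y =>
    isOpen_prod_iff.1 hW infty y (hCcov (mem_range_self y))
  obtain ⟨T, hT, hTcov⟩ := LindelofSpace.elim_nhds_subcover B fun y => (hB y).mem_nhds (hyB y)
  have := isPSpace.countableInterFilter_nhds (infty : OnePointLindelof D)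
  obtain ⟨V, hVsub, hV, hVinf⟩ := mem_nhds_iff.1
    ((countable_bInter_mem hT).2 fun y _ => (hA y).mem_nhds (hAinf y))
  have hrest : IsLindelof (⋃ d ∈ ((coe ⁻¹' V)ᶜ : Set D), range fun y : Y => (coe d, y)) :=
    (isOpen_iff.1 hV hVinf).isLindelof_biUnion fun d _ => hslice _
  obtain ⟨C', hC', hCcov'⟩ := hrest.elim_countable_subcover U hU ((subset_univ _).trans hcov)
  refine ⟨C ∪ C', hC.union hC', ?_⟩
  rintro ⟨x, y⟩ -
  rw [biUnion_union]
  by_cases hx : x ∈ V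
  · left
    obtain ⟨t, ht, hyt⟩ := mem_iUnion₂.1 (hTcov.symm ▸ mem_univ y)
    exact hsub t ⟨mem_iInter₂.1 (hVsub hx) t ht, hyt⟩
  · right
    cases x with
    | none => exact absurd hVinf hx
    | some d => exact hCcov' (mem_biUnion (x := d) hx (mem_range_self y))

instance lindelofSpace_pi (n : ℕ) : LindelofSpace (Fin n → OnePointLindelof D) := by
  induction n with
  | zero => infer_instance
  | succ n ih =>
    refine LindelofSpace.of_continuous_surjective
      (f := fun p : OnePointLindelof D × (Fin n → OnePointLindelof D) =>
        (Fin.cons p.1 p.2 : Fin (n + 1) → OnePointLindelof D)) ?_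
      fun x => ⟨(x 0, Fin.tail x), Fin.cons_self_tail x⟩
    exact Continuous.finCons (A := fun _ => OnePointLindelof D) continuous_fst continuous_snd

/-- All but countably many points go to `∞`, so the retraction is continuous even into the discrete
topology. -/
theorem isOpen_preimage_retract {E : Set D} (hE : E.Countable) (s : Set (OnePointLindelof D)) :
    IsOpen (retract E ⁻¹' s) := by
  refine isOpen_iff.2 fun h => hE.mono fun d hd => ?_
  by_contra hdE
  refine hd ?_
  rw [mem_preimage, mem_preimage, retract_coe_of_notMem hdE]
  exact h

end OnePointLindelof

/-! ### Structure of the free topological group of `D ∪ {∞}` -/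

namespace FreeTopGroup

variable {X : Type u}

theorem hom_ext {M : Type*} [Monoid M] {f g : FreeTopGroup X →* M}
    (h : ∀ x, f (of x) = g (of x)) : f = g :=
  FreeGroup.ext_hom (α := X) f g h

/-- The free topological group of a `P`-space is a `P`-space. -/
theorem isPSpace [TopologicalSpace X] (hX : IsPSpace X) : IsPSpace (FreeTopGroup X) := by
  intro s hs
  obtain ⟨φ, hφ, hφof⟩ := exists_continuous_lift (H := PModification (FreeTopGroup X))
    (fun x : X => (of x : FreeTopGroup X))
    (PModification.continuous_of_toOriginal hX.countableInterFilter_nhds continuous_of)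
  -- The identity is thus continuous into the `P`-modification, so `G_δ`-sets are already open.
  have hid : φ = MonoidHom.id (FreeTopGroup X) := hom_ext (M := FreeTopGroup X) hφof
  have := (PModification.isOpen_preimage_toOriginal hs).preimage hφ
  rw [hid] at this
  exact this

/-- The words with a given length `n` and sign pattern form a continuous image of `X ^ n`, and there
are only countably many patterns. -/
theorem lindelofSpace [TopologicalSpace X] (hX : ∀ n : ℕ, LindelofSpace (Fin n → X)) :
    LindelofSpace (FreeTopGroup X) := by
  let w : ∀ p : Σ n : ℕ, Fin n → Bool, (Fin p.1 → X) → FreeTopGroup X := fun p x =>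
    (List.ofFn fun i => cond (p.2 i) (of (x i)) (of (x i))⁻¹).prod
  have hw : ∀ p, Continuous (w p) := by
    intro p
    have : w p = fun x => ((List.finRange p.1).map
        fun i => cond (p.2 i) (of (x i)) (of (x i))⁻¹).prod := by
      funext x
      simp only [w, List.ofFn_eq_map]
    rw [this]
    refine continuous_list_prod _ fun i _ => ?_
    cases p.2 i
    · exact (continuous_of.comp (continuous_apply i)).inv
    · exact continuous_of.comp (continuous_apply i)
  have hcov : (⋃ p, range (w p)) = univ := by
    refine eq_univ_of_forall fun g => ?_
    obtain ⟨L, rfl⟩ := Quot.exists_rep (r := FreeGroup.Red.Step (α := X)) g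
    refine mem_iUnion.2 ⟨⟨L.length, fun i => (L.get i).2⟩, fun i => (L.get i).1, ?_⟩
    have h1 : (FreeGroup.lift (fun x : X => (of x : FreeTopGroup X)) : FreeGroup X →* _)
        (FreeGroup.mk L) = (L.map fun x => cond x.2 (of x.1) (of x.1)⁻¹).prod :=
      FreeGroup.lift_mk
    have h2 : (FreeGroup.lift (fun x : X => (of x : FreeTopGroup X)) :
        FreeTopGroup X →* FreeTopGroup X) = MonoidHom.id _ :=
      hom_ext fun x => FreeGroup.lift_apply_of
    refine Eq.trans ?_ (h1.symm.trans (DFunLike.congr_fun h2 (FreeGroup.mk L)))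
    simp only [w]
    congr 1
    conv_rhs => rw [← List.ofFn_get L, List.map_ofFn]
    rfl
  refine ⟨?_⟩
  rw [← hcov]
  exact isLindelof_iUnion fun p => by
    have := hX p.1
    exact isLindelof_range (hw p)

variable {D : Type u}

open OnePointLindelof

/-- The homomorphism of free groups induced by the retraction of `D ∪ {∞}` onto `E ∪ {∞}`. -/
noncomputable def retractHom (E : Set D) :
    FreeTopGroup (OnePointLindelof D) →* FreeGroup (OnePointLindelof D) :=
  FreeGroup.map (retract E)

theorem retractHom_of (E : Set D) (x : OnePointLindelof D) :
    retractHom E (of x) = FreeGroup.of (retract E x) := FreeGroup.map.of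

theorem retractHom_eq_of_subset {E E' : Set D} (h : E ⊆ E')
    {g g' : FreeTopGroup (OnePointLindelof D)} (hg : retractHom E' g = retractHom E' g') :
    retractHom E g = retractHom E g' := by
  have : retractHom E = (FreeGroup.map (retract E)).comp (retractHom E') :=
    hom_ext fun x => by
      rw [MonoidHom.comp_apply, retractHom_of, retractHom_of, FreeGroup.map.of, retract_retract h]
  rw [this, MonoidHom.comp_apply, MonoidHom.comp_apply, hg]

/-- A word involves only finitely many letters. Hence the `r_E` separate points. -/
theorem exists_countable_retractHom_eq_self (g : FreeTopGroup (OnePointLindelof D)) :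
    ∃ E : Set D, E.Countable ∧ ∀ E', E ⊆ E' → retractHom E' g = g := by
  induction g using FreeGroup.induction_on with
  | C1 => exact ⟨∅, countable_empty, fun E' _ => map_one (retractHom E')⟩
  | of x =>
    cases x with
    | none => exact ⟨∅, countable_empty, fun E' _ => retractHom_of E' infty⟩
    | some d =>
      refine ⟨{d}, countable_singleton d, fun E' h => (retractHom_of E' (coe d)).trans ?_⟩
      rw [retract_coe_of_mem (h rfl)]
      rfl
  | inv_of x ih =>
    obtain ⟨E, hE, h⟩ := ih
    refine ⟨E, hE, fun E' hE' => (map_inv (retractHom E') (of x)).trans ?_⟩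
    exact congrArg (fun z : FreeGroup _ => z⁻¹) (h E' hE')
  | mul x y ihx ihy =>
    obtain ⟨E, hE, h⟩ := ihx
    obtain ⟨E', hE', h'⟩ := ihy
    refine ⟨E ∪ E', hE.union hE', fun E'' hsub => (map_mul (retractHom E'') x y).trans ?_⟩
    exact congrArg₂ (fun z w : FreeGroup _ => z * w) (h E'' (subset_union_left.trans hsub))
      (h' E'' (subset_union_right.trans hsub))

theorem retractHom_coe_mul_inv_infty_eq_one_iff (E : Set D) (d : D) :
    retractHom E (of (coe d) * (of infty)⁻¹) = 1 ↔ d ∉ E := by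
  rw [map_mul, map_inv, mul_inv_eq_one, retractHom_of, retractHom_of,
    FreeGroup.of_injective.eq_iff, retract_infty]
  by_cases h : d ∈ E
  · rw [retract_coe_of_mem h]
    exact iff_of_false (Option.some_ne_none d) (not_not.2 h)
  · rw [retract_coe_of_notMem h]
    exact iff_of_true rfl h

/-- A compact space with an action of `F(X)` that contains `F(X)`. -/
abbrev CompactModel (D : Type u) : Type u :=
  {E : Set D // E.Countable} × FreeGroup (OnePointLindelof D) → Bool

/-- On the block of coordinates indexed by `E`, `g` acts as left translation by `r_E(g)`. -/
noncomputable instance : MulAction (FreeTopGroup (OnePointLindelof D)) (CompactModel D) where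
  smul g y p := y (p.1, (retractHom (p.1 : Set D) g)⁻¹ * p.2)
  one_smul y := by
    funext p
    change y (p.1, (retractHom (p.1 : Set D) 1)⁻¹ * p.2) = y p
    simp
  mul_smul g h y := by
    funext p
    change y (p.1, (retractHom (p.1 : Set D) (g * h))⁻¹ * p.2) =
      y (p.1, (retractHom (p.1 : Set D) h)⁻¹ * ((retractHom (p.1 : Set D) g)⁻¹ * p.2))
    simp [mul_assoc]

theorem CompactModel.smul_apply (g : FreeTopGroup (OnePointLindelof D)) (y : CompactModel D)
    (p : {E : Set D // E.Countable} × FreeGroup (OnePointLindelof D)) :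
    (g • y) p = y (p.1, (retractHom (p.1 : Set D) g)⁻¹ * p.2) := rfl

open scoped Classical in
/-- The embedding of `F(X)` into `CompactModel D`. -/
noncomputable def toCompactModel (g : FreeTopGroup (OnePointLindelof D)) : CompactModel D :=
  fun p => decide (retractHom (p.1 : Set D) g = p.2)

variable [TopologicalSpace D] [DiscreteTopology D]

theorem isOpen_preimage_retractHom {E : Set D} (hE : E.Countable)
    (s : Set (FreeGroup (OnePointLindelof D))) : IsOpen (retractHom E ⁻¹' s) := by
  let : TopologicalSpace (FreeGroup (OnePointLindelof D)) := ⊥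
  have : DiscreteTopology (FreeGroup (OnePointLindelof D)) := ⟨rfl⟩
  obtain ⟨φ, hφ, hφof⟩ := exists_continuous_lift
    (fun x : OnePointLindelof D => FreeGroup.of (retract E x))
    (continuous_def.2 fun s _ => isOpen_preimage_retract hE (FreeGroup.of ⁻¹' s))
  have : φ = retractHom E := hom_ext fun x => (hφof x).trans (retractHom_of E x).symm
  rw [← this]
  exact (isOpen_discrete s).preimage hφ

instance : LindelofSpace (FreeTopGroup (OnePointLindelof D)) := lindelofSpace inferInstance

/-- The kernels of the retractions onto countable sets form a base at the neutral element. -/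
theorem exists_retractHom_subset_of_mem_nhds_one {U : Set (FreeTopGroup (OnePointLindelof D))}
    (hU : U ∈ 𝓝 1) : ∃ E : Set D, E.Countable ∧ ∀ g, retractHom E g = 1 → g ∈ U := by
  obtain ⟨N, hN, hN1, hNU⟩ :=
    exists_normal_subgroup_subset (isPSpace OnePointLindelof.isPSpace) hU
  have hc : Continuous fun x : OnePointLindelof D => of x * (of infty)⁻¹ :=
    continuous_of.mul continuous_const
  obtain ⟨V, hVN, hV, hVinf⟩ := mem_nhds_iff.1
    (hc.continuousAt (x := infty) |>.preimage_mem_nhds (by simpa using hN1))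
  refine ⟨(coe ⁻¹' V)ᶜ, OnePointLindelof.isOpen_iff.1 hV hVinf, fun g hg => hNU ?_⟩
  let q := QuotientGroup.mk' N
  let q' : FreeGroup (OnePointLindelof D) →* FreeTopGroup (OnePointLindelof D) ⧸ N := q
  -- Letters outside this countable set are congruent to `∞` modulo `N`, so collapsing them does not
  -- change the class.
  have hq : q = q'.comp (retractHom ((coe ⁻¹' V)ᶜ)) := hom_ext fun x => by
    rw [MonoidHom.comp_apply, retractHom_of]
    change q (of x) = q (of (retract _ x))
    cases x with
    | none => rfl
    | some d =>
      change q (of (coe d)) = q (of (retract _ (coe d)))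
      by_cases hd : d ∈ ((coe ⁻¹' V)ᶜ : Set D)
      · rw [retract_coe_of_mem hd]
      · rw [retract_coe_of_notMem hd, ← mul_inv_eq_one, ← map_inv, ← map_mul]
        exact (QuotientGroup.eq_one_iff _).2 (hVN (not_not.1 hd))
  refine (QuotientGroup.eq_one_iff g).1 (?_ : q g = 1)
  rw [hq, MonoidHom.comp_apply, hg, map_one]

theorem exists_retractHom_subset {U : Set (FreeTopGroup (OnePointLindelof D))} (hU : IsOpen U)
    {g : FreeTopGroup (OnePointLindelof D)} (hg : g ∈ U) :
    ∃ E : Set D, E.Countable ∧ ∀ h, retractHom E h = retractHom E g → h ∈ U := by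
  obtain ⟨E, hE, h⟩ := exists_retractHom_subset_of_mem_nhds_one
    ((continuous_const_mul g).continuousAt (x := 1) |>.preimage_mem_nhds
      (by simpa using hU.mem_nhds hg))
  refine ⟨E, hE, fun k hk => ?_⟩
  simpa using h (g⁻¹ * k) (by rw [map_mul, map_inv, hk, inv_mul_cancel])

/-- A coordinate of `g • y` depends on `g` only through the locally constant `r_E(g)`; near a given
point it is evaluation of `y` at a fixed coordinate. -/
instance : ContinuousSMul (FreeTopGroup (OnePointLindelof D)) (CompactModel D) where
  continuous_smul := by
    refine continuous_pi fun p => continuous_iff_continuousAt.2 fun z => ?_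
    have hc : Continuous fun z' : FreeTopGroup (OnePointLindelof D) × CompactModel D =>
        z'.2 (p.1, (retractHom (p.1 : Set D) z.1)⁻¹ * p.2) :=
      (continuous_apply _).comp continuous_snd
    refine hc.continuousAt.congr ?_
    have hopen := (isOpen_preimage_retractHom p.1.2 {retractHom (p.1 : Set D) z.1}).preimage
      (continuous_fst (Y := CompactModel D))
    filter_upwards [hopen.mem_nhds rfl] with z' hz'
    rw [CompactModel.smul_apply, show retractHom (p.1 : Set D) z'.1 = _ from hz']

open scoped Classical in
-- Coordinate `(E, r_E(g))` cuts out exactly the coset `g · ker r_E`, and these cosets form a base.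
theorem isEmbedding_toCompactModel :
    IsEmbedding (toCompactModel : FreeTopGroup (OnePointLindelof D) → CompactModel D) := by
  have heq : ∀ (E : Set D) (hE : E.Countable) (g h : FreeTopGroup (OnePointLindelof D)),
      toCompactModel h (⟨E, hE⟩, retractHom E g) = true ↔ retractHom E h = retractHom E g :=
    fun E hE g h => by simp [toCompactModel]
  refine ⟨⟨le_antisymm ?_ ?_⟩, fun g h hgh => ?_⟩
  · refine continuous_iff_le_induced.1 (continuous_pi fun p => ?_)
    exact continuous_def.2 fun s _ =>
      isOpen_preimage_retractHom p.1.2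
        {a | decide (a = p.2) ∈ s}
  · intro U hU
    refine (@isOpen_iff_forall_mem_open _ (.induced toCompactModel inferInstance) _).2
      fun g hg => ?_
    obtain ⟨E, hE, hsub⟩ := exists_retractHom_subset hU hg
    refine ⟨toCompactModel ⁻¹' {y | y (⟨E, hE⟩, retractHom E g) = true},
      fun h hh => hsub h ((heq E hE g h).1 hh), ?_, (heq E hE g g).2 rfl⟩
    have hc : Continuous fun y : CompactModel D => y (⟨E, hE⟩, retractHom E g) :=
      continuous_apply _
    exact isOpen_induced ((isOpen_discrete {true}).preimage hc)
  · obtain ⟨E, hE, hEg⟩ := exists_countable_retractHom_eq_self g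
    obtain ⟨E', hE', hEh⟩ := exists_countable_retractHom_eq_self h
    have := (heq (E ∪ E') (hE.union hE') h g).1 (by rw [hgh]; exact (heq _ _ h h).2 rfl)
    rw [hEg _ subset_union_left, hEh _ subset_union_right] at this
    exact this

theorem hasGCompactification :
    HasGCompactification (FreeTopGroup (OnePointLindelof D))
      (FreeTopGroup (OnePointLindelof D)) := by
  refine hasGCompactification_of_isEmbedding isEmbedding_toCompactModel fun g x => ?_
  funext p
  rw [CompactModel.smul_apply]
  refine decide_eq_decide.2 ?_
  rw [smul_eq_mul, map_mul, eq_inv_mul_iff_mul_eq]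

theorem not_isOpen_singleton [Uncountable D] (g : FreeTopGroup (OnePointLindelof D)) :
    ¬ IsOpen {g} := by
  intro hg
  obtain ⟨E, hE, h⟩ := exists_retractHom_subset hg rfl
  obtain ⟨d, hd⟩ : ∃ d, d ∉ E := by
    by_contra! hcon
    exact not_countable (α := D) (countable_univ_iff.1 (hE.mono fun d _ => hcon d))
  have h1 := h (g * (of (coe d) * (of infty)⁻¹)) (by
    rw [map_mul, (retractHom_coe_mul_inv_infty_eq_one_iff E d).2 hd, mul_one])
  -- Openness of `{g}` would force `d ∞⁻¹ = 1`, which `r_{d}` detects as false.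
  have h2 := (retractHom_coe_mul_inv_infty_eq_one_iff {d} d).1 (by
    rw [mul_eq_left.1 h1, map_one])
  exact h2 rfl

/-- For `d` before `d'`, `r_{<d'}(g) = 1` forces `r_{≤d}(g) = 1`, so the sets attached to `d` and
`d'` are disjoint; the one attached to `d` contains `d ∞⁻¹`. -/
theorem not_isCCC [Uncountable D] {r : D → D → Prop} [IsStrictTotalOrder D r]
    (hr : ∀ d, {x | r x d}.Countable) : ¬ IsCCC (FreeTopGroup (OnePointLindelof D)) := by
  intro hccc
  refine not_countable (α := D) (hccc.countable_index (fun d =>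
    retractHom {x | r x d} ⁻¹' {1} ∩ retractHom (insert d {x | r x d}) ⁻¹' {1}ᶜ)
    (fun d => (isOpen_preimage_retractHom (hr d) _).inter
      (isOpen_preimage_retractHom ((hr d).insert d) _)) (fun d => ?_) ?_)
  · refine ⟨of (coe d) * (of infty)⁻¹, ?_, fun h => ?_⟩
    · exact (retractHom_coe_mul_inv_infty_eq_one_iff _ d).2 (irrefl_of r d)
    · exact (retractHom_coe_mul_inv_infty_eq_one_iff _ d).1 h (mem_insert _ _)
  · have key : ∀ d d', r d d' →
        Disjoint (retractHom (insert d {x | r x d}) ⁻¹' {1}ᶜ)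
          (retractHom {x | r x d'} ⁻¹' ({1} : Set (FreeGroup (OnePointLindelof D)))) := by
      refine fun d d' h => Set.disjoint_left.2 fun g hg hg' => hg ?_
      have := retractHom_eq_of_subset (E := insert d {x | r x d}) (E' := {x | r x d'})
        (insert_subset h fun x hx => trans_of r hx h) (g := g) (g' := 1)
        (by rw [map_one]; exact hg')
      rwa [map_one] at this
    intro d d' hne
    rcases trichotomous_of r d d' with h | h | h
    · exact (key d d' h).mono inter_subset_right inter_subset_left
    · exact absurd h hne
    · exact ((key d' d h).mono inter_subset_right inter_subset_left).symm

end FreeTopGroup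

/-! ### The counterexample -/

theorem mainTheorem8 (D : Type u) [TopologicalSpace D] [DiscreteTopology D]
    (hD : #D = ℵ_ 1) :
    -- the one-point Lindelöfication `X` of `D`
    (T35Space (OnePointLindelof D) ∧ IsPSpace (OnePointLindelof D) ∧
      ∀ n : ℕ, LindelofSpace (Fin n → OnePointLindelof D)) ∧
    -- its free topological group `F(X)`
    T35Space (FreeTopGroup (OnePointLindelof D)) ∧
    IsOmegaNarrow (FreeTopGroup (OnePointLindelof D)) ∧
    LindelofSpace (FreeTopGroup (OnePointLindelof D)) ∧
    IsPSpace (FreeTopGroup (OnePointLindelof D)) ∧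
    (∀ g : FreeTopGroup (OnePointLindelof D), ¬ IsOpen {g}) ∧
    HasGCompactification (FreeTopGroup (OnePointLindelof D))
      (FreeTopGroup (OnePointLindelof D)) ∧
    ¬ IsSkeletallyDugundji (FreeTopGroup (OnePointLindelof D)) ∧
    -- continuous transitive actions with a `G`-compactification do not suffice
    (¬ ∀ (G X : Type u) [Group G] [TopologicalSpace G] [TopologicalSpace X] [MulAction G X],
      T35Space G → T35Space X → IsSemitopologicalGroup G → IsOmegaNarrow G →
      ContinuousSMul G X → MulAction.IsPretransitive G X → HasGCompactification G X →
      IsSkeletallyDugundji X) ∧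
    (¬ ∀ (G X : Type u) [Group G] [TopologicalSpace G] [TopologicalSpace X] [MulAction G X],
      T35Space G → T35Space X → IsSemitopologicalGroup G → IsOmegaNarrow G →
      ContinuousSMul G X → MulAction.IsPretransitive G X → HasGCompactification G X →
      IsOpenlyDugundji X) := by
  have : Uncountable D := by
    rw [← Cardinal.aleph0_lt_mk_iff, hD]
    exact Cardinal.aleph0_lt_aleph_one
  have hT : T35Space (FreeTopGroup (OnePointLindelof D)) :=
    FreeTopGroup.isEmbedding_toCompactModel.t35Space
  have hN := isOmegaNarrow_of_lindelofSpace (FreeTopGroup (OnePointLindelof D))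
  have hS : IsSemitopologicalGroup (FreeTopGroup (OnePointLindelof D)) :=
    fun a => ⟨continuous_const_mul a, continuous_mul_const a⟩
  have hG := FreeTopGroup.hasGCompactification (D := D)
  have hnot : ¬ IsSkeletallyDugundji (FreeTopGroup (OnePointLindelof D)) := by
    intro h
    -- A well-order of type `ω₁`, so that proper initial segments are countable.
    obtain ⟨r, _, hr⟩ := Cardinal.exists_ord_eq D
    refine FreeTopGroup.not_isCCC (r := r) (fun d => ?_) h.isCCC
    have := Cardinal.card_typein_lt d hr
    rw [hD, Cardinal.lt_aleph_one_iff] at this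
    exact Cardinal.le_aleph0_iff_set_countable.1 this
  refine ⟨⟨inferInstance, OnePointLindelof.isPSpace, inferInstance⟩, hT, hN, inferInstance,
    FreeTopGroup.isPSpace OnePointLindelof.isPSpace, FreeTopGroup.not_isOpen_singleton, hG, hnot,
    fun h => hnot (h _ _ hT hT hS hN inferInstance inferInstance hG),
    fun h => hnot (h _ _ hT hT hS hN inferInstance inferInstance hG).isSkeletallyDugundji⟩
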